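/- For a finite simple graph $G$ and a function $f:\mathbb N\to\mathbb R$ (with $0\in\mathbb N$) let $e_f(G)=\sum_{x\in V(G)} f(d_G(x))$, where $d_G(x)$ is the degree of $x$ in $G$. Let $\mathrm{ex}_f(n,F)$ be the maximum of $e_f(G)$ over all graphs $G$ of order $n$ that do not contain $F$ as a (not necessarily induced) subgraph, and let $\mathrm{ex}'_f(n,F)$ be the maximum of $e_f(H)$ over all complete $(\chi(F)-1)$-partite graphs $H$ of order $n$, where $\chi(F)$ is the chromatic number of $F$ and parts may be empty. A non-decreasing function $f:\mathbb N\to\mathbb R$ is called log-continuous if for every $\varepsilon>0$ there is $\delta>0$ such that $f(m)\le(1+\varepsilon)f(n)$ for all $m,n\in\mathbb N$ with $n\le m\le(1+\delta)n$. Theorem. Let $F$ be a fixed finite non-bipartite graph and let $f:\mathbb N\to\mathbb R$ be an arbitrary non-decreasing and log-continuous function. Then, as $n\to\infty$, $$\mathrm{ex}_f(n,F)=(1+o(1))\,\mathrm{ex}'_f(n,F).$$ -/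

import Mathlib

open scoped Asymptotics

namespace DegreeTuran

/-- A function `f : ℕ → ℝ` is log-continuous if it is non-decreasing and for every `ε > 0` there is
`δ > 0` such that `f m ≤ (1 + ε) f n` whenever `n ≤ m ≤ (1 + δ) n`. -/
def LogContinuous (f : ℕ → ℝ) : Prop :=
  Monotone f ∧ ∀ ε : ℝ, 0 < ε → ∃ δ : ℝ, 0 < δ ∧
    ∀ m n : ℕ, n ≤ m → (m : ℝ) ≤ (1 + δ) * (n : ℝ) → f m ≤ (1 + ε) * f n

open Classical in
/-- `e_f(G)`, the sum of `f (d(x))` over all vertices `x` of `G`. -/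
noncomputable def degreeSum (f : ℕ → ℝ) {V : Type*} [Fintype V] (G : SimpleGraph V) : ℝ :=
  ∑ x : V, f (G.degree x)

/-- `H` is a complete `k`-partite graph: its vertex set is split into `k` (possibly empty) parts,
and two vertices are adjacent exactly when they lie in different parts. -/
def IsCompletePartite (k : ℕ) {V : Type*} (H : SimpleGraph V) : Prop :=
  ∃ part : V → Fin k, ∀ x y : V, H.Adj x y ↔ part x ≠ part y

/-- `ex_f(n, F)`, the maximum of `e_f(G)` over all `F`-free graphs `G` of order `n`. -/
noncomputable def exDeg (f : ℕ → ℝ) (n : ℕ) {W : Type*} (F : SimpleGraph W) : ℝ :=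
  sSup {s : ℝ | ∃ G : SimpleGraph (Fin n), F.Free G ∧ s = degreeSum f G}

/-- `ex'_f(n, F)`, the maximum of `e_f(H)` over all complete `(χ(F) - 1)`-partite graphs `H` of
order `n`. -/
noncomputable def exDegPartite (f : ℕ → ℝ) (n : ℕ) {W : Type*} (F : SimpleGraph W) : ℝ :=
  sSup {s : ℝ | ∃ H : SimpleGraph (Fin n),
    IsCompletePartite (F.chromaticNumber.toNat - 1) H ∧ s = degreeSum f H}

/-- The chromatic number of a finite non-bipartite graph is at least three. -/
theorem three_le_chromaticNumber {W : Type*} [Finite W] {F : SimpleGraph W}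
    (hF : ¬ F.IsBipartite) : 3 ≤ F.chromaticNumber.toNat := by
  by_contra h
  have := Fintype.ofFinite W
  have hc : F.Colorable F.chromaticNumber.toNat :=
    SimpleGraph.colorable_chromaticNumber F.colorable_of_fintype
  exact hF (hc.mono (by omega))

/-- For a non-bipartite `F`, the supremum in `exDeg` is an attained maximum. -/
theorem isGreatest_exDeg (f : ℕ → ℝ) (n : ℕ) {W : Type*} {F : SimpleGraph W}
    (hF : ¬ F.IsBipartite) :
    IsGreatest {s : ℝ | ∃ G : SimpleGraph (Fin n), F.Free G ∧ s = degreeSum f G}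
      (exDeg f n F) := by
  have hfin : {s : ℝ | ∃ G : SimpleGraph (Fin n), F.Free G ∧ s = degreeSum f G}.Finite :=
    (Set.finite_range (fun G : SimpleGraph (Fin n) => degreeSum f G)).subset
      (by rintro s ⟨G, -, rfl⟩; exact ⟨G, rfl⟩)
  refine ⟨Set.Nonempty.csSup_mem ⟨_, ⊥, ?_, rfl⟩ hfin, fun s hs => le_csSup hfin.bddAbove hs⟩
  rintro ⟨φ⟩
  exact hF ⟨SimpleGraph.Coloring.mk (fun _ => 0) fun h => absurd (φ.toHom.map_adj h) (by simp)⟩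

/-- For a finite non-bipartite `F`, the supremum in `exDegPartite` is an attained maximum. -/
theorem isGreatest_exDegPartite (f : ℕ → ℝ) (n : ℕ) {W : Type*} [Finite W] {F : SimpleGraph W}
    (hF : ¬ F.IsBipartite) :
    IsGreatest {s : ℝ | ∃ H : SimpleGraph (Fin n),
      IsCompletePartite (F.chromaticNumber.toNat - 1) H ∧ s = degreeSum f H}
      (exDegPartite f n F) := by
  have hfin : {s : ℝ | ∃ H : SimpleGraph (Fin n),
      IsCompletePartite (F.chromaticNumber.toNat - 1) H ∧ s = degreeSum f H}.Finite :=
    (Set.finite_range (fun G : SimpleGraph (Fin n) => degreeSum f G)).subset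
      (by rintro s ⟨G, -, rfl⟩; exact ⟨G, rfl⟩)
  have h3 := three_le_chromaticNumber hF
  exact ⟨Set.Nonempty.csSup_mem ⟨_, ⊥, ⟨fun _ => ⟨0, by omega⟩, by simp⟩, rfl⟩ hfin,
    fun s hs => le_csSup hfin.bddAbove hs⟩

end DegreeTuran

/-! The lower bound holds because a complete `(χ(F) - 1)`-partite graph is `F`-free. For the upper
bound put `r = χ(F) - 1`. An `F`-free graph has `o(n ^ (r + 1))` ordered `(r + 1)`-cliques, since a
positive density of them would force a blow-up containing `F` (`le_card_blowups`,
`eventually_card_cliqueTuples_le`).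

A robust form of Erdős's degree majorization (`exists_coloring_of_card_cliqueTuples_le`) then gives
an `r`-partition that dominates the degrees of `G` up to an additive `#B`, outside a set `B` of
`o(n)` vertices. Rebalancing (`exists_coloring_degree_add_le`) turns the additive error into a
factor `1 + δ`, which log-continuity tolerates. The vertices of `B` contribute at most `#B * f n`,
negligible because `f n = O(f (n / 2))` and `n * f (n / 2)` is at most the multipartite maximum. -/

namespace DegreeTuran

open Finset Filter

/-! ### Clique counts and degree majorization -/

section Cliques

open scoped Classical

variable {V : Type*}

/-- The ordered `k`-cliques of `G` with all entries in `S`. -/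
noncomputable def cliqueTuples [Fintype V] (G : SimpleGraph V) (k : ℕ) (S : Finset V) :
    Finset (Fin k → V) :=
  {w | (∀ i, w i ∈ S) ∧ Pairwise fun i j => G.Adj (w i) (w j)}

theorem sum_card_cliqueTuples_le [Fintype V] (G : SimpleGraph V) (k : ℕ) (S : Finset V) :
    ∑ x ∈ S, #(cliqueTuples G k {y ∈ S | G.Adj x y}) ≤ #(cliqueTuples G (k + 1) S) := by
  rw [← card_sigma]
  refine card_le_card_of_injOn (fun p => Fin.cons p.1 p.2) ?_ ?_
  · rintro ⟨x, w⟩ h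
    simp only [cliqueTuples, coe_sigma, Set.mem_sigma_iff, mem_coe, mem_filter, mem_univ,
      true_and] at h ⊢
    obtain ⟨hx, hw, hp⟩ := h
    refine ⟨Fin.cases (by simpa using hx) fun i => by simpa using (hw i).1, ?_⟩
    intro i j hij
    induction i using Fin.cases with
    | zero =>
      induction j using Fin.cases with
      | zero => exact absurd rfl hij
      | succ j => simpa using (hw j).2
    | succ i =>
      induction j using Fin.cases with
      | zero => simpa using (hw i).2.symm
      | succ j => simpa using hp fun h => hij (congrArg Fin.succ h)
  · rintro ⟨x, w⟩ - ⟨y, z⟩ - h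
    obtain ⟨h₁, h₂⟩ := Fin.cons_inj.1 h
    simp only at h₁ h₂
    subst h₁ h₂
    rfl

/-- A graph with few `(r + 1)`-cliques is, up to few exceptional vertices, dominated in degrees by
a complete `r`-partite graph. -/
theorem exists_coloring_of_card_cliqueTuples_le (r : ℕ) : ∀ η : ℝ, 0 < η → ∃ γ : ℝ, 0 < γ ∧
    ∀ {V : Type*} [Fintype V] (G : SimpleGraph V) (N : ℝ) (S : Finset V), 0 < N →
      (#(cliqueTuples G (r + 1) S) : ℝ) ≤ γ * N ^ (r + 1) →
      ∃ (B : Finset V) (c : V → ℕ), (#B : ℝ) ≤ η * N ∧ (∀ x ∈ S, x ∉ B → c x < r) ∧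
        ∀ x ∈ S, x ∉ B → #{y ∈ S | G.Adj x y} ≤ #{y ∈ S | y ∈ B ∨ c y ≠ c x} := by
  induction r with
  | zero =>
    intro η hη
    refine ⟨η, hη, fun G N S _ h => ⟨S, fun _ => 0, ?_, by grind, by grind⟩⟩
    have : #S ≤ #(cliqueTuples G (0 + 1) S) := by
      have := sum_card_cliqueTuples_le G 0 S
      refine le_trans ?_ this
      rw [card_eq_sum_ones]
      refine sum_le_sum fun x _ => card_pos.2 ⟨Fin.elim0, ?_⟩
      simp only [cliqueTuples, mem_filter, mem_univ, true_and]
      exact ⟨fun i => i.elim0, fun i => i.elim0⟩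
    calc (#S : ℝ) ≤ #(cliqueTuples G (0 + 1) S) := by exact_mod_cast this
      _ ≤ η * N := by simpa using h
  | succ r ih =>
    intro η hη
    obtain ⟨γ, hγ, ih⟩ := ih (η / 2) (by positivity)
    refine ⟨γ * (η / 2), by positivity, fun {V} _ G N S hN h => ?_⟩
    set D : V → Finset V := fun x => {y ∈ S | G.Adj x y} with hD
    -- Vertices whose neighbourhood is too rich in cliques for the induction; counting cliques by
    -- first vertex bounds their number.
    set bad : Finset V := {x ∈ S | γ * N ^ (r + 1) < #(cliqueTuples G (r + 1) (D x))} with hbad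
    have hbadcard : (#bad : ℝ) ≤ η / 2 * N := by
      have hpos : 0 < γ * N ^ (r + 1) := by positivity
      refine le_of_mul_le_mul_right ?_ hpos
      calc (#bad : ℝ) * (γ * N ^ (r + 1)) = ∑ x ∈ bad, γ * N ^ (r + 1) := by simp
        _ ≤ ∑ x ∈ bad, (#(cliqueTuples G (r + 1) (D x)) : ℝ) :=
          sum_le_sum fun x hx => (mem_filter.1 hx).2.le
        _ ≤ ∑ x ∈ S, (#(cliqueTuples G (r + 1) (D x)) : ℝ) :=
          sum_le_sum_of_subset_of_nonneg (filter_subset _ _) fun _ _ _ => by positivity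
        _ ≤ #(cliqueTuples G (r + 1 + 1) S) := by
          exact_mod_cast sum_card_cliqueTuples_le G (r + 1) S
        _ ≤ _ := h
        _ = _ := by ring
    have hηN : 0 < η * N := by positivity
    obtain hemp | hne := (S \ bad).eq_empty_or_nonempty
    · have hSb : S ⊆ bad := sdiff_eq_empty_iff_subset.1 hemp
      exact ⟨bad, fun _ => 0, by linarith, fun x hx hb => absurd (hSb hx) hb,
        fun x hx hb => absurd (hSb hx) hb⟩
    -- Erdős's choice: for `x` of maximum degree outside `bad`, `S \ D x` becomes the new part `r`
    -- and the induction partitions `D x`. The scale `N` stays fixed while `S` shrinks.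
    obtain ⟨x, hx, hmax⟩ := exists_max_image (S \ bad) (fun y => #(D y)) hne
    obtain ⟨hxS, hxb⟩ := Finset.mem_sdiff.1 hx
    have hxc : (#(cliqueTuples G (r + 1) (D x)) : ℝ) ≤ γ * N ^ (r + 1) := by
      by_contra hcon
      exact hxb (mem_filter.2 ⟨hxS, not_le.1 hcon⟩)
    obtain ⟨B, c, hB, hcr, hdeg⟩ := ih G N (D x) hN hxc
    refine ⟨bad ∪ B, fun y => if y ∈ D x then c y else r, ?_, ?_, ?_⟩
    · have : (#(bad ∪ B) : ℝ) ≤ #bad + #B := by exact_mod_cast card_union_le _ _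
      linarith
    · intro y _ hyB
      have hyB' : y ∉ B := fun h => hyB (mem_union_right _ h)
      by_cases hyD : y ∈ D x
      · simpa [hyD] using (hcr y hyD hyB').trans (Nat.lt_succ_self r)
      · simp [hyD]
    · intro y hyS hyB
      have hyB' : y ∉ B := fun h => hyB (mem_union_right _ h)
      have hyb : y ∉ bad := fun h => hyB (mem_union_left _ h)
      by_cases hyD : y ∈ D x
      · calc #{z ∈ S | G.Adj y z} ≤ #(S \ D x ∪ {z ∈ D x | G.Adj y z}) :=
              card_le_card (by grind)
          _ ≤ #(S \ D x) + #{z ∈ D x | G.Adj y z} := card_union_le _ _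
          _ ≤ #(S \ D x) + #{z ∈ D x | z ∈ B ∨ c z ≠ c y} := by
            exact Nat.add_le_add_left (hdeg y hyD hyB') _
          _ = #(S \ D x ∪ {z ∈ D x | z ∈ B ∨ c z ≠ c y}) :=
            (card_union_of_disjoint (by
              rw [disjoint_left]; intro z hz hz'
              exact (Finset.mem_sdiff.1 hz).2 (mem_filter.1 hz').1)).symm
          _ ≤ _ := card_le_card (by
            have := hcr y hyD hyB'
            intro z hz
            have hDS : D x ⊆ S := filter_subset _ _
            by_cases hzD : z ∈ D x
            · simp only [mem_union, Finset.mem_sdiff, mem_filter] at hz ⊢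
              simp only [hzD, hyD, if_true]
              have := hDS hzD
              tauto
            · simp only [mem_union, Finset.mem_sdiff, mem_filter] at hz ⊢
              simp only [hzD, hyD, if_true, if_false]
              refine ⟨by tauto, Or.inr (by omega)⟩)
      · calc #{z ∈ S | G.Adj y z} ≤ #(D x) := hmax y (Finset.mem_sdiff.2 ⟨hyS, hyb⟩)
          _ ≤ _ := card_le_card (by
            intro z hz
            have hDS : D x ⊆ S := filter_subset _ _
            simp only [mem_union, mem_filter, hz, hyD, if_true, if_false]
            refine ⟨hDS hz, ?_⟩
            by_cases hzB : z ∈ B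
            · exact Or.inl (Or.inr hzB)
            · exact Or.inr (hcr z hz hzB).ne)

/-! ### Supersaturation: dense cliques force a copy of `F` -/

/-- The `W`-blow-ups of a `k`-uniform hypergraph given as a set of ordered edges. -/
noncomputable def blowups [Fintype V] (W : Type*) [Fintype W] {k : ℕ} (P : Finset (Fin k → V)) :
    Finset (Fin k → W → V) :=
  {a | ∀ j : Fin k → W, (fun i => a i (j i)) ∈ P}

/-- The power mean inequality for finite sums. -/
theorem card_mul_pow_le_sum_pow {ι : Type*} [Fintype ι] (g : ι → ℝ) (hg : ∀ i, 0 ≤ g i) (p : ℕ)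
    {m : ℝ} (hm : 0 ≤ m) (h : Fintype.card ι * m ≤ ∑ i, g i) :
    Fintype.card ι * m ^ p ≤ ∑ i, g i ^ p := by
  rcases isEmpty_or_nonempty ι with _ | _
  · simp
  have hc : (0 : ℝ) < Fintype.card ι := by exact_mod_cast Fintype.card_pos
  have hJ := Real.pow_arith_mean_le_arith_mean_pow univ (fun _ : ι => (Fintype.card ι : ℝ)⁻¹) g
    (fun _ _ => by positivity) (by simp [hc.ne']) (fun i _ => hg i) p
  rw [← mul_sum, ← mul_sum] at hJ
  have hm' : m ≤ (Fintype.card ι : ℝ)⁻¹ * ∑ i, g i := by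
    rwa [inv_mul_eq_div, le_div_iff₀ hc, mul_comm]
  calc Fintype.card ι * m ^ p ≤ Fintype.card ι * ((Fintype.card ι : ℝ)⁻¹ * ∑ i, g i) ^ p := by
        gcongr
    _ ≤ Fintype.card ι * ((Fintype.card ι : ℝ)⁻¹ * ∑ i, g i ^ p) := by gcongr
    _ = _ := by field_simp

theorem sum_card_blowups_le [Fintype V] (W : Type*) [Fintype W] {k : ℕ}
    (P : Finset (Fin (k + 1) → V)) :
    ∑ b : W → V, #(blowups W {w : Fin k → V | ∀ s, (Fin.cons (b s) w : Fin (k + 1) → V) ∈ P}) ≤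
      #(blowups W P) := by
  rw [← card_sigma]
  refine card_le_card_of_injOn (fun p => Fin.cons p.1 p.2) ?_ ?_
  · rintro ⟨b, a⟩ h
    simp only [blowups, coe_sigma, Set.mem_sigma_iff, mem_coe, mem_filter, mem_univ,
      true_and] at h ⊢
    intro j
    convert h (fun i => j i.succ) (j 0) using 1
    funext i
    induction i using Fin.cases <;> simp
  · rintro ⟨x, w⟩ - ⟨y, z⟩ - h
    obtain ⟨h₁, h₂⟩ := Fin.cons_inj.1 h
    simp only at h₁ h₂
    subst h₁ h₂
    rfl

theorem card_eq_sum_card_tail [Fintype V] {k : ℕ} (P : Finset (Fin (k + 1) → V)) :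
    ∑ w : Fin k → V, #{v : V | (Fin.cons v w : Fin (k + 1) → V) ∈ P} = #P := by
  rw [← card_sigma]
  refine card_nbij' (fun p => Fin.cons p.2 p.1) (fun q => ⟨Fin.tail q, q 0⟩) ?_ ?_ ?_ ?_
  · rintro ⟨w, v⟩ h; simpa using h
  · intro q h; simpa using h
  · rintro ⟨w, v⟩ h; simp
  · intro q h; simp

/-- Double counting of pairs `(b, w)`: for fixed `w`, each entry of `b` is an independent choice
among the extensions of `w`. -/
theorem sum_card_link_eq [Fintype V] (W : Type*) [Fintype W] {k : ℕ}
    (P : Finset (Fin (k + 1) → V)) :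
    ∑ b : W → V, #{w : Fin k → V | ∀ s, (Fin.cons (b s) w : Fin (k + 1) → V) ∈ P} =
      ∑ w : Fin k → V, #{v : V | (Fin.cons v w : Fin (k + 1) → V) ∈ P} ^ Fintype.card W := by
  refine (sum_card_bipartiteAbove_eq_sum_card_bipartiteBelow
    (fun (b : W → V) (w : Fin k → V) => ∀ s, (Fin.cons (b s) w : Fin (k + 1) → V) ∈ P)).trans ?_
  refine sum_congr rfl fun w _ => ?_
  rw [← card_univ, ← prod_const, ← Fintype.card_piFinset]
  congr 1
  ext b
  simp [bipartiteBelow, Fintype.mem_piFinset]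

/-- A positive proportion of edges yields a positive proportion of blow-ups. -/
theorem le_card_blowups [Fintype V] (W : Type*) [Fintype W] (k : ℕ) :
    ∀ (P : Finset (Fin k → V)) (γ : ℝ), 0 ≤ γ → γ * (Fintype.card V : ℝ) ^ k ≤ #P →
      γ ^ (Fintype.card W ^ k) * ((Fintype.card V : ℝ) ^ Fintype.card W) ^ k ≤
        #(blowups W P) := by
  induction k with
  | zero =>
    intro P γ hγ h
    have : #P ≤ #(blowups W P) := by
      refine card_le_card_of_injOn (fun _ => Fin.elim0) ?_ ?_
      · intro w hw
        simp only [blowups, mem_coe, mem_filter, mem_univ, true_and] at hw ⊢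
        intro j
        convert hw
      · intro a _ b _ _
        exact Subsingleton.elim _ _
    have : (#P : ℝ) ≤ #(blowups W P) := by exact_mod_cast this
    simpa using (by simpa using h : γ ≤ #P).trans this
  | succ k ih =>
    intro P γ hγ h
    rcases isEmpty_or_nonempty V with hV | hV
    · rcases isEmpty_or_nonempty W with hW | hW
      · have hb : blowups W P = univ := by
          ext a; simp only [blowups, mem_filter, mem_univ, true_and, iff_true]
          exact fun j => isEmptyElim (j 0)
        rw [hb]; simp
      · simp
    set n : ℝ := ((Fintype.card V : ℕ) : ℝ) with hn
    have hn0 : 0 < n := by rw [hn]; exact_mod_cast Fintype.card_pos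
    set t := Fintype.card W with ht
    set L : (W → V) → Finset (Fin k → V) :=
      fun b => {w | ∀ s, (Fin.cons (b s) w : Fin (k + 1) → V) ∈ P} with hL
    -- Convexity over tails: the common links `L b` have average density at least `γ ^ t`.
    have h₁ : n ^ k * (γ * n) ^ t ≤ ∑ b, (#(L b) : ℝ) := by
      have hcard : ((Fintype.card (Fin k → V) : ℕ) : ℝ) = n ^ k := by simp [hn]
      have := card_mul_pow_le_sum_pow
        (fun w : Fin k → V => (#{v : V | (Fin.cons v w : Fin (k + 1) → V) ∈ P} : ℝ))
        (fun _ => by positivity) t (m := γ * n) (by positivity) (by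
          rw [hcard]
          calc n ^ k * (γ * n) = γ * n ^ (k + 1) := by ring
            _ ≤ #P := h
            _ = _ := by rw [← card_eq_sum_card_tail P]; push_cast; rfl)
      rw [hcard] at this
      refine this.trans_eq ?_
      have h2 := sum_card_link_eq W P
      rw [hL]
      exact_mod_cast h2.symm
    -- Convexity again, now over `b`, with the exponent that the induction hypothesis puts on the
    -- density of `L b`.
    have h₂ : n ^ t * (γ ^ t) ^ (t ^ k) ≤ ∑ b, ((#(L b) : ℝ) / n ^ k) ^ (t ^ k) := by
      have hcard : ((Fintype.card (W → V) : ℕ) : ℝ) = n ^ t := by simp [hn, ht]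
      have := card_mul_pow_le_sum_pow (fun b : W → V => (#(L b) : ℝ) / n ^ k)
        (fun _ => by positivity) (t ^ k) (m := γ ^ t) (by positivity) (by
          rw [hcard, ← sum_div, le_div_iff₀ (by positivity)]
          refine le_trans (le_of_eq ?_) h₁
          ring)
      rwa [hcard] at this
    calc γ ^ (t ^ (k + 1)) * (n ^ t) ^ (k + 1)
        = (n ^ t * (γ ^ t) ^ (t ^ k)) * (n ^ t) ^ k := by rw [← pow_mul]; ring
      _ ≤ (∑ b, ((#(L b) : ℝ) / n ^ k) ^ (t ^ k)) * (n ^ t) ^ k := by gcongr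
      _ = ∑ b, ((#(L b) : ℝ) / n ^ k) ^ (t ^ k) * (n ^ t) ^ k := sum_mul _ _ _
      _ ≤ ∑ b, (#(blowups W (L b)) : ℝ) := by
        refine sum_le_sum fun b _ => ih (L b) _ (by positivity) ?_
        rw [div_mul_cancel₀ _ (by positivity)]
      _ ≤ #(blowups W P) := by exact_mod_cast sum_card_blowups_le W P

theorem isContained_of_mem_blowups [Fintype V] {W : Type*} [Fintype W] {F : SimpleGraph W}
    {G : SimpleGraph V} {k : ℕ} (c : F.Coloring (Fin k)) {a : Fin k → W → V}
    (ha : a ∈ blowups W (cliqueTuples G k univ))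
    (hinj : Function.Injective fun p : Fin k × W => a p.1 p.2) : F.IsContained G := by
  refine ⟨⟨⟨fun w => a (c w) w, ?_⟩, ?_⟩⟩
  · intro w w' h
    have hc : c w ≠ c w' := c.valid h
    -- This selector picks copy `w` in class `c w` and copy `w'` elsewhere, so a single clique
    -- contains both images.
    have := (mem_filter.1 ha).2 (Function.update (fun _ => w') (c w) w)
    have := (mem_filter.1 this).2.2 hc
    simpa [hc.symm] using this
  · intro w w' h
    exact congrArg Prod.snd (@hinj (c w, w) (c w', w') h)

/-- An `F`-free graph on many vertices has few cliques of order `χ(F)`. -/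
theorem eventually_card_cliqueTuples_le {W : Type*} [Fintype W] {F : SimpleGraph W} {k : ℕ}
    (hF : F.Colorable k) {γ : ℝ} (hγ : 0 < γ) :
    ∀ᶠ n : ℕ in atTop, ∀ G : SimpleGraph (Fin n), F.Free G →
      (#(cliqueTuples G k univ) : ℝ) ≤ γ * (n : ℝ) ^ k := by
  obtain ⟨c⟩ := hF
  set t := Fintype.card W with ht
  have hε : 0 < γ ^ (t ^ k) := by positivity
  -- Only `o(n ^ (k * t))` arrays are non-injective, so a positive density of blow-ups includes an
  -- injective one.
  have hdesc := (isEquivalent_descFactorial (k * t)).isLittleO.def (half_pos hε)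
  filter_upwards [hdesc, eventually_gt_atTop 0] with n hn hn0 G hG
  by_contra! hcon
  have hb := le_card_blowups W k (cliqueTuples G k univ) γ hγ.le (by simpa using hcon.le)
  set I : Finset (Fin k → W → Fin n) :=
    {a | Function.Injective fun p : Fin k × W => a p.1 p.2} with hI
  have hIcard : #I = n.descFactorial (k * t) := by
    have : n.descFactorial (k * t) = Fintype.card (Fin k × W ↪ Fin n) := by
      simp [Fintype.card_embedding_eq, ht]
    rw [this, ← card_univ]
    symm
    refine card_bij (fun e _ i s => e (i, s)) ?_ ?_ ?_
    · intro e _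
      simpa [hI] using e.injective
    · intro e _ e' _ h
      ext ⟨i, s⟩
      exact congrArg Fin.val (congrFun (congrFun h i) s)
    · intro a ha
      exact ⟨⟨_, (mem_filter.1 ha).2⟩, mem_univ _, rfl⟩
  have hdisj : Disjoint (blowups W (cliqueTuples G k univ)) I := by
    rw [disjoint_left]
    intro a ha ha'
    exact hG (isContained_of_mem_blowups c ha (mem_filter.1 ha').2)
  have htot : #(blowups W (cliqueTuples G k univ)) + #I ≤ n ^ (k * t) := by
    rw [← card_union_of_disjoint hdisj]
    refine (card_le_univ _).trans_eq ?_
    simp [← pow_mul, ht, mul_comm]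
  have htot' : (#(blowups W (cliqueTuples G k univ)) : ℝ) + #I ≤ (n : ℝ) ^ (k * t) := by
    exact_mod_cast htot
  have hpos : (0 : ℝ) < (n : ℝ) ^ (k * t) := by positivity
  simp only [Fintype.card_fin, ← pow_mul] at hb
  simp only [Pi.sub_apply, Real.norm_eq_abs, abs_of_pos hpos] at hn
  have := (abs_le.1 hn).1
  rw [hIcard] at htot'
  have := mul_pos hε hpos
  rw [mul_comm (Fintype.card W) k, ← ht] at hb
  linarith

end Cliques

/-! ### Growth of log-continuous functions -/

section Growth

variable {f : ℕ → ℝ}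

/-- Log-continuity at `m = n = 0` with `ε = 1` gives `f 0 ≤ 2 * f 0`. -/
theorem LogContinuous.nonneg (hf : LogContinuous f) (n : ℕ) : 0 ≤ f n := by
  obtain ⟨δ, -, h⟩ := hf.2 1 one_pos
  have h0 := h 0 0 le_rfl (by simp)
  exact le_trans (by linarith) (hf.1 n.zero_le)

theorem LogContinuous.exists_le_mul_half (hf : LogContinuous f) :
    ∃ C : ℝ, 0 < C ∧ ∀ᶠ n : ℕ in atTop, f n ≤ C * f (n / 2) := by
  obtain ⟨δ, hδ, h⟩ := hf.2 1 one_pos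
  -- Stepping by `1 + δ / 2` instead of `1 + δ` leaves room for the floor once `x` passes this
  -- threshold.
  have hstep : ∀ x : ℝ, 2 * (1 + δ) / δ ≤ x → f ⌊(1 + δ / 2) * x⌋₊ ≤ 2 * f ⌊x⌋₊ := by
    intro x hx
    have hx0 : 0 ≤ x := le_trans (by positivity) hx
    rw [div_le_iff₀ hδ] at hx
    refine (h _ _ (Nat.floor_mono (le_mul_of_one_le_left hx0 (by linarith))) ?_).trans_eq (by ring)
    calc (⌊(1 + δ / 2) * x⌋₊ : ℝ) ≤ (1 + δ / 2) * x := Nat.floor_le (by positivity)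
      _ ≤ (1 + δ) * (x - 1) := by nlinarith
      _ ≤ (1 + δ) * ⌊x⌋₊ := by
        gcongr
        exact (Nat.sub_one_lt_floor x).le
  have hiter : ∀ (j : ℕ) (x : ℝ), 2 * (1 + δ) / δ ≤ x →
      f ⌊(1 + δ / 2) ^ j * x⌋₊ ≤ 2 ^ j * f ⌊x⌋₊ := by
    intro j x hx
    have hx0 : 0 ≤ x := le_trans (by positivity) hx
    induction j with
    | zero => simp
    | succ j ih =>
      have h1 : 1 ≤ (1 + δ / 2) ^ j := one_le_pow₀ (by linarith)
      calc f ⌊(1 + δ / 2) ^ (j + 1) * x⌋₊ = f ⌊(1 + δ / 2) * ((1 + δ / 2) ^ j * x)⌋₊ := by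
            congr 2; ring
        _ ≤ 2 * f ⌊(1 + δ / 2) ^ j * x⌋₊ := hstep _ (hx.trans (le_mul_of_one_le_left hx0 h1))
        _ ≤ 2 * (2 ^ j * f ⌊x⌋₊) := by gcongr
        _ = _ := by ring
  -- Factor `3`, not `2`, because `n / 2` rounds down.
  obtain ⟨j, hj⟩ := pow_unbounded_of_one_lt 3 (show 1 < 1 + δ / 2 by linarith)
  refine ⟨2 ^ j, by positivity, ?_⟩
  have hlim : Tendsto (fun n : ℕ => ((n / 2 : ℕ) : ℝ)) atTop atTop :=
    tendsto_natCast_atTop_atTop.comp (Nat.tendsto_div_const_atTop two_ne_zero)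
  filter_upwards [hlim.eventually_ge_atTop (2 * (1 + δ) / δ), eventually_ge_atTop 2] with n hn hn2
  have := hiter j _ hn
  rw [Nat.floor_natCast] at this
  refine (hf.1 (Nat.le_floor ?_)).trans this
  calc (n : ℝ) ≤ 3 * ((n / 2 : ℕ) : ℝ) := by exact_mod_cast (by omega : n ≤ 3 * (n / 2))
    _ ≤ _ := by gcongr

end Growth

/-! ### Multipartite graphs and the comparison -/

section Multipartite

open scoped Classical

theorem degreeSum_eq_sum_card_filter (f : ℕ → ℝ) {V : Type*} [Fintype V] (G : SimpleGraph V) :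
    degreeSum f G = ∑ x, f #{y | G.Adj x y} := by
  unfold degreeSum
  refine sum_congr rfl fun x _ => ?_
  rw [← SimpleGraph.card_neighborFinset_eq_degree, SimpleGraph.neighborFinset_eq_filter]

theorem degreeSum_comap_top (f : ℕ → ℝ) {V : Type*} [Fintype V] {k : ℕ} (c : V → Fin k) :
    degreeSum f ((⊤ : SimpleGraph (Fin k)).comap c) = ∑ x, f #{y | c y ≠ c x} := by
  simp [degreeSum_eq_sum_card_filter, ne_comm]

theorem isCompletePartite_comap_top {V : Type*} {k : ℕ} (c : V → Fin k) :
    IsCompletePartite k ((⊤ : SimpleGraph (Fin k)).comap c) :=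
  ⟨c, fun x y => by simp⟩

theorem IsCompletePartite.colorable {k : ℕ} {V : Type*} {H : SimpleGraph V}
    (h : IsCompletePartite k H) : H.Colorable k := by
  obtain ⟨c, hc⟩ := h
  exact ⟨SimpleGraph.Coloring.mk c fun {x y} h => (hc x y).1 h⟩

theorem sum_le_exDegPartite (f : ℕ → ℝ) {n : ℕ} {W : Type*} [Finite W] {F : SimpleGraph W}
    (hF : ¬F.IsBipartite) (c : Fin n → Fin (F.chromaticNumber.toNat - 1)) :
    ∑ x, f #{y | c y ≠ c x} ≤ exDegPartite f n F :=
  (isGreatest_exDegPartite f n hF).2 ⟨_, isCompletePartite_comap_top c,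
    (degreeSum_comap_top f c).symm⟩

theorem exDegPartite_le_exDeg (f : ℕ → ℝ) (n : ℕ) {W : Type*} [Finite W] {F : SimpleGraph W}
    (hF : ¬F.IsBipartite) : exDegPartite f n F ≤ exDeg f n F := by
  obtain ⟨H, hH, hs⟩ := (isGreatest_exDegPartite f n hF).1
  refine (isGreatest_exDeg f n hF).2 ⟨H, ?_, hs⟩
  rintro ⟨φ⟩
  have h3 := three_le_chromaticNumber hF
  have := (SimpleGraph.Colorable.of_hom φ.toHom hH.colorable).chromaticNumber_le
  have := ENat.toNat_le_of_le_natCast this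
  omega

/-- Witnessed by the balanced complete bipartite graph, all other parts being empty. -/
theorem mul_half_le_exDegPartite {f : ℕ → ℝ} (hf : Monotone f) (n : ℕ) {W : Type*} [Finite W]
    {F : SimpleGraph W} (hF : ¬F.IsBipartite) : n * f (n / 2) ≤ exDegPartite f n F := by
  have h3 := three_le_chromaticNumber hF
  set c : Fin n → Fin (F.chromaticNumber.toNat - 1) :=
    fun x => if x.val < n / 2 then ⟨0, by omega⟩ else ⟨1, by omega⟩ with hc
  refine le_trans ?_ (sum_le_exDegPartite f hF c)
  have hlt : #{y : Fin n | y.val < n / 2} = n / 2 := by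
    rw [Fin.card_filter_val_lt]; omega
  have hge : n / 2 ≤ #{y : Fin n | ¬ y.val < n / 2} := by
    have := card_filter_add_card_filter_not (s := (univ : Finset (Fin n)))
      (fun y => y.val < n / 2)
    rw [hlt, card_univ, Fintype.card_fin] at this
    omega
  calc (n : ℝ) * f (n / 2) = ∑ _x : Fin n, f (n / 2) := by simp
    _ ≤ _ := sum_le_sum fun x _ => hf ?_
  by_cases hx : x.val < n / 2
  · refine hge.trans (card_le_card fun y hy => ?_)
    simp only [mem_filter, mem_univ, true_and] at hy ⊢
    simp [hc, hx, hy]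
  · refine hlt.ge.trans (card_le_card fun y hy => ?_)
    simp only [mem_filter, mem_univ, true_and] at hy ⊢
    simp [hc, hx, hy]

/-- Any complete `r`-partite graph can be modified so that, up to a factor `1 + δ`, each degree
increases by a positive proportion of the number of vertices. -/
theorem exists_coloring_degree_add_le {r : ℕ} (hr : 2 ≤ r) {δ : ℝ} (hδ : 0 < δ) :
    ∃ η : ℝ, 0 < η ∧ ∀ᶠ n : ℕ in atTop, ∀ c : Fin n → Fin r, ∃ c' : Fin n → Fin r, ∀ x,
      (#{y | c y ≠ c x} : ℝ) + η * n ≤ (1 + δ) * #{y | c' y ≠ c' x} := by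
  wlog hδ1 : δ ≤ 1 generalizing δ
  · obtain ⟨η, hη, h⟩ := this one_pos le_rfl
    refine ⟨η, hη, h.mono fun n hn c => ?_⟩
    obtain ⟨c', hc'⟩ := hn c
    refine ⟨c', fun x => (hc' x).trans ?_⟩
    gcongr
    linarith
  set α : ℝ := δ / 10 with hα
  have hα0 : 0 < α := by positivity
  have hlim : Tendsto (fun n : ℕ => α * (n : ℝ)) atTop atTop :=
    tendsto_natCast_atTop_atTop.const_mul_atTop hα0
  refine ⟨α * δ, by positivity, ?_⟩
  filter_upwards [hlim.eventually_ge_atTop 1] with n hn c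
  have hn0 : (0 : ℝ) ≤ n := n.cast_nonneg
  have hsplit : ∀ i, (#{y | c y = i} : ℝ) + #{y | c y ≠ i} = n := fun i => by
    have := card_filter_add_card_filter_not (s := (univ : Finset (Fin n))) (fun y => c y = i)
    rw [card_univ, Fintype.card_fin] at this
    exact_mod_cast this
  -- If no part exceeds `(1 - α) * n`, all degrees are at least `α * n` and `c` itself works.
  -- Otherwise `⌈α * n⌉₊` vertices `M` leave the huge part `P`: those staying gain `#M`, and all
  -- others end with degree at least `(1 - 3 * α) * n`.
  by_cases hbig : ∃ i, (1 - α) * n < #{y | c y = i}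
  · obtain ⟨i, hi⟩ := hbig
    set P : Finset (Fin n) := {y | c y = i} with hP
    have hmle : (⌈α * n⌉₊ : ℝ) ≤ 2 * (α * n) := by
      have := Nat.ceil_lt_add_one (show 0 ≤ α * n by positivity)
      linarith
    have hmge := Nat.le_ceil (α * n)
    have hδn : δ * n ≤ 1 * n := by gcongr
    have hmP : ⌈α * n⌉₊ ≤ #P := by
      have : (⌈α * n⌉₊ : ℝ) ≤ #P := by rw [hα] at *; linarith
      exact_mod_cast this
    obtain ⟨M, hMP, hM⟩ := exists_subset_card_eq hmP
    have : Nontrivial (Fin r) := Fin.nontrivial_iff_two_le.2 hr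
    obtain ⟨i', hi'⟩ := exists_ne i
    have hPM : (1 - 3 * α) * n ≤ #(P \ M) := by
      have : (#(P \ M) : ℝ) + #M = #P := by exact_mod_cast card_sdiff_add_card_eq_card hMP
      rw [hM] at this
      linarith
    set c' : Fin n → Fin r := fun y => if y ∈ M then i' else c y with hc'
    refine ⟨c', fun x => ?_⟩
    by_cases hx : x ∈ P \ M
    · obtain ⟨hxP, hxM⟩ := Finset.mem_sdiff.1 hx
      have hcx : c x = i := (mem_filter.1 hxP).2
      have hle : #{y | c y ≠ c x} + #M ≤ #{y | c' y ≠ c' x} := by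
        rw [← card_union_of_disjoint]
        · refine card_le_card fun y hy => ?_
          simp only [mem_union, mem_filter, mem_univ, true_and, hc', hxM, if_false, hcx] at hy ⊢
          split_ifs with h
          · exact hi'
          · tauto
        · rw [disjoint_left]
          intro y hy hyM
          exact (mem_filter.1 hy).2 ((mem_filter.1 (hMP hyM)).2.trans hcx.symm)
      have hle' : (#{y | c y ≠ c x} : ℝ) + #M ≤ #{y | c' y ≠ c' x} := by exact_mod_cast hle
      rw [hM] at hle'
      have h0 : (0 : ℝ) ≤ #{y | c' y ≠ c' x} := Nat.cast_nonneg _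
      nlinarith
    · have hle : #(P \ M) ≤ #{y | c' y ≠ c' x} := by
        refine card_le_card fun y hy => ?_
        obtain ⟨hyP, hyM⟩ := Finset.mem_sdiff.1 hy
        have hcy : c y = i := (mem_filter.1 hyP).2
        simp only [mem_filter, mem_univ, true_and, hc', hyM, if_false, hcy]
        split_ifs with h
        · exact hi'.symm
        · intro h'
          exact hx (Finset.mem_sdiff.2 ⟨mem_filter.2 ⟨mem_univ _, h'.symm⟩, h⟩)
      have hle' : (1 - 3 * α) * n ≤ #{y | c' y ≠ c' x} := hPM.trans (by exact_mod_cast hle)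
      have hd : (#{y | c y ≠ c x} : ℝ) ≤ n := by
        have := hsplit (c x)
        have : (0 : ℝ) ≤ #{y | c y = c x} := Nat.cast_nonneg _
        linarith
      have hcoef : 1 + α * δ ≤ (1 + δ) * (1 - 3 * α) := by rw [hα]; nlinarith
      calc (#{y | c y ≠ c x} : ℝ) + α * δ * n ≤ (1 + α * δ) * n := by linarith
        _ ≤ (1 + δ) * (1 - 3 * α) * n := by gcongr
        _ = (1 + δ) * ((1 - 3 * α) * n) := by ring
        _ ≤ _ := by gcongr
  · push Not at hbig
    refine ⟨c, fun x => ?_⟩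
    have h1 := hbig (c x)
    have h2 := hsplit (c x)
    have h3 : α * n ≤ #{y | c y ≠ c x} := by linarith
    have := mul_le_mul_of_nonneg_left h3 hδ.le
    linarith

theorem eventually_exDeg_le {W : Type*} [Finite W] {F : SimpleGraph W} (hF : ¬F.IsBipartite)
    {f : ℕ → ℝ} (hf : LogContinuous f) {ε : ℝ} (hε : 0 < ε) :
    ∀ᶠ n : ℕ in atTop, exDeg f n F ≤ (1 + ε) * exDegPartite f n F := by
  have := Fintype.ofFinite W
  have h3 := three_le_chromaticNumber hF
  obtain ⟨r, hr⟩ : ∃ r, r = F.chromaticNumber.toNat - 1 := ⟨_, rfl⟩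
  have hcol : F.Colorable (r + 1) := by
    rw [hr, Nat.sub_add_cancel (by omega)]
    exact SimpleGraph.colorable_chromaticNumber F.colorable_of_fintype
  obtain ⟨C, hC, hhalf⟩ := hf.exists_le_mul_half
  obtain ⟨δ, hδ, hlog⟩ := hf.2 (ε / 2) (half_pos hε)
  obtain ⟨η₁, hη₁, hbal⟩ := exists_coloring_degree_add_le (r := r) (by omega) hδ
  -- `η₁` lets rebalancing absorb `#B` in each degree; `ε / (2 * C)` keeps the contribution of `B`
  -- below `ε / 2` of the maximum.
  obtain ⟨γ, hγ, hdom⟩ := exists_coloring_of_card_cliqueTuples_le r (min η₁ (ε / (2 * C)))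
    (by positivity)
  filter_upwards [hhalf, hbal, eventually_card_cliqueTuples_le hcol hγ, eventually_gt_atTop 0]
    with n hhalf hbal hfew hn
  have hn' : (0 : ℝ) < n := by exact_mod_cast hn
  obtain ⟨G, hG, hs⟩ := (isGreatest_exDeg f n hF).1
  rw [hs, degreeSum_eq_sum_card_filter]
  obtain ⟨B, c, hB, hcr, hdeg⟩ := hdom G n univ hn' (hfew G hG)
  have hB₁ : (#B : ℝ) ≤ η₁ * n := hB.trans (by gcongr; exact min_le_left _ _)
  have hB₂ : (#B : ℝ) ≤ ε / (2 * C) * n := hB.trans (by gcongr; exact min_le_right _ _)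
  -- The default colour is harmless: it is only used on `B`, which the degree bound counts in full.
  set c₀ : Fin n → Fin r := fun x => if h : c x < r then ⟨c x, h⟩ else ⟨0, by omega⟩ with hc₀
  obtain ⟨c', hc'⟩ := hbal c₀
  have hgood : ∀ x, x ∉ B → f #{y | G.Adj x y} ≤ (1 + ε / 2) * f #{y | c' y ≠ c' x} := by
    intro x hx
    have hle : #{y | G.Adj x y} ≤ #B + #{y | c₀ y ≠ c₀ x} := by
      refine (hdeg x (mem_univ _) hx).trans (le_trans (card_le_card fun y hy => ?_)
        (card_union_le _ _))
      simp only [mem_union, mem_filter, mem_univ, true_and] at hy ⊢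
      by_cases hyB : y ∈ B
      · exact Or.inl hyB
      · refine Or.inr fun h => hy.elim hyB fun h' => h' ?_
        simpa [hc₀, hcr x (mem_univ _) hx, hcr y (mem_univ _) hyB] using h
    have hle' : (#{y | G.Adj x y} : ℝ) ≤ (1 + δ) * #{y | c' y ≠ c' x} := by
      have : (#{y | G.Adj x y} : ℝ) ≤ #B + #{y | c₀ y ≠ c₀ x} := by exact_mod_cast hle
      have := hc' x
      linarith
    rcases le_total #{y | c' y ≠ c' x} #{y | G.Adj x y} with h | h
    · exact hlog _ _ h hle'
    · have h0 := hf.nonneg #{y | c' y ≠ c' x}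
      have := hf.1 h
      nlinarith
  have hbad : ∀ x, f #{y | G.Adj x y} ≤ f n := fun x =>
    hf.1 ((card_le_univ _).trans_eq (Fintype.card_fin n))
  have hpart : ∑ x, f #{y | c' y ≠ c' x} ≤ exDegPartite f n F := by
    subst hr
    exact sum_le_exDegPartite f hF c'
  have hfn := hf.nonneg n
  calc ∑ x, f #{y | G.Adj x y}
      = ∑ x ∈ B, f #{y | G.Adj x y} + ∑ x ∈ Bᶜ, f #{y | G.Adj x y} :=
        (sum_add_sum_compl _ _).symm
    _ ≤ ∑ x ∈ B, f n + ∑ x ∈ Bᶜ, (1 + ε / 2) * f #{y | c' y ≠ c' x} :=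
        add_le_add (sum_le_sum fun x _ => hbad x)
          (sum_le_sum fun x hx => hgood x (mem_compl.1 hx))
    _ ≤ ∑ x ∈ B, f n + ∑ x, (1 + ε / 2) * f #{y | c' y ≠ c' x} := by
        gcongr
        · intro x _ _
          have := hf.nonneg #{y | c' y ≠ c' x}
          positivity
        · exact subset_univ _
    _ = #B * f n + (1 + ε / 2) * ∑ x, f #{y | c' y ≠ c' x} := by simp [mul_sum]
    _ ≤ ε / (2 * C) * n * (C * f (n / 2)) + (1 + ε / 2) * exDegPartite f n F := by gcongr
    _ = ε / 2 * (n * f (n / 2)) + (1 + ε / 2) * exDegPartite f n F := by field_simp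
    _ ≤ ε / 2 * exDegPartite f n F + (1 + ε / 2) * exDegPartite f n F := by
        gcongr
        exact mul_half_le_exDegPartite hf.1 n hF
    _ = _ := by ring

end Multipartite

end DegreeTuran

theorem theorem2 {W : Type*} [Finite W] (F : SimpleGraph W) (hF : ¬ F.IsBipartite)
    (f : ℕ → ℝ) (hf : DegreeTuran.LogContinuous f) :
    (fun n : ℕ => DegreeTuran.exDeg f n F) ~[Filter.atTop]
      (fun n : ℕ => DegreeTuran.exDegPartite f n F) := by
  refine Asymptotics.IsLittleO.of_bound fun ε hε => ?_
  filter_upwards [DegreeTuran.eventually_exDeg_le hF hf hε] with n hn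
  have h1 := DegreeTuran.exDegPartite_le_exDeg f n hF
  have h0 : 0 ≤ DegreeTuran.exDegPartite f n F :=
    (mul_nonneg n.cast_nonneg (hf.nonneg _)).trans
      (DegreeTuran.mul_half_le_exDegPartite hf.1 n hF)
  rw [Pi.sub_apply, Real.norm_of_nonneg (sub_nonneg.2 h1), Real.norm_of_nonneg h0]
  linarith
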